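/- Let $\Bbbk$ be a field and let $\mathcal{A}s$ be the symmetric $\Bbbk$-linear operad of unital associative algebras: for all $n\ge 0$, $\mathcal{A}s(n)=\Bbbk\mathbb{S}_n$ with the right regular action of the symmetric group $\mathbb{S}_n$, and the composition is the multilinear extension of $\sigma\circ(\sigma_1,\dots,\sigma_n)=\vartheta_{n;k_1,\dots,k_n}(\sigma,\sigma_1,\dots,\sigma_n)$ for $\sigma\in\mathbb{S}_n$, $\sigma_i\in\mathbb{S}_{k_i}$, where $\vartheta$ is the block permutation: writing a permutation $\rho$ as the sequence $(\rho^{-1}(1),\rho^{-1}(2),\dots)$, it is $(\tilde B_{\sigma^{-1}(1)},\dots,\tilde B_{\sigma^{-1}(n)})$ with $\tilde B_i=(m_i+\sigma_i^{-1}(1),\dots,m_i+\sigma_i^{-1}(k_i))$ and $m_i=k_1+\dots+k_{i-1}$. Let $1_n$ be the unit of $\mathbb{S}_n$. An operadic ideal of $\mathcal{A}s$ is a family $\mathcal{I}=(\mathcal{I}(n))_{n\ge0}$ of $\mathbb{S}_n$-submodules $\mathcal{I}(n)\subseteq\mathcal{A}s(n)$ such that $\theta\circ(\theta_1,\dots,\theta_n)$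 lies in $\mathcal{I}$ whenever one of $\theta,\theta_1,\dots,\theta_n$ does; then $(\mathcal{A}s/\mathcal{I})(n)=\mathcal{A}s(n)/\mathcal{I}(n)$. For $J\subseteq\{1,\dots,n\}$ with characteristic function $\chi_J$ let $\pi^J\colon\mathcal{A}s(n)\to\mathcal{A}s(|J|)$, $\pi^J(\theta)=\theta\circ(1_{\chi_J(1)},\dots,1_{\chi_J(n)})$. For $k\ge1$ the $k$-th truncation ${}^k\mathcal{U}$ of $\mathcal{A}s$ is ${}^k\mathcal{U}(n)=\bigcap_{|J|\le k-1}\ker\pi^J$ (so ${}^k\mathcal{U}(n)=\bigcap_{|J|=k-1}\ker\pi^J$ if $n\ge k$, and ${}^k\mathcal{U}(n)=0$ if $n<k$). The Gelfand–Kirillov dimension of $\mathcal{P}=(\mathcal{P}(n))_{n\ge0}$ is $$\operatorname{GKdim}\mathcal{P}=\limsup_{n\to\infty}\log_n\Big(\sum_{i=0}^n\dim_{\Bbbk}\mathcal{P}(i)\Big)\in[-\infty,\infty],$$ where $\log_n 0=-\infty$. Let $k$ be a positive integer. Then ${}^k\mathcal{U}$ is an operadic ideal of $\mathcal{A}s$,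 and for every operadic ideal $\mathcal{I}$ of $\mathcal{A}s$, $$\operatorname{GKdim}(\mathcal{A}s/\mathcal{I})\le k\quad\text{if and only if}\quad \mathcal{I}\supseteq{}^k\mathcal{U}.$$ Moreover, $$\operatorname{GKdim}(\mathcal{A}s/{}^k\mathcal{U})=\begin{cases}1,& k=1,2,\\ k,& k\ge3.\end{cases}$$ -/

import Mathlib

open scoped BigOperators

namespace AsOperad

universe u v

/-- The block permutation `ϑ_{n; k₁, …, kₙ}(σ, σ₁, …, σₙ)`.

`{1, …, k₁ + ⋯ + kₙ}` is cut into consecutive blocks of lengths `k₁, …, kₙ`.  The `j`-th place of the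
`i`-th block is sent to the `σᵢ(j)`-th place of the `σ(i)`-th block of the cutting into consecutive
blocks of lengths `k_{σ⁻¹(1)}, …, k_{σ⁻¹(n)}`.  Equivalently, if a permutation `ρ` is written as
the sequence `(ρ⁻¹(1), ρ⁻¹(2), …)`, this is the sequence `(B_{σ⁻¹(1)}, …, B_{σ⁻¹(n)})`, where
`Bᵢ = (mᵢ + σᵢ⁻¹(1), …, mᵢ + σᵢ⁻¹(kᵢ))` and `mᵢ = k₁ + ⋯ + k_{i-1}`. -/
def blockPerm {n : ℕ} {k : Fin n → ℕ} (σ : Equiv.Perm (Fin n))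
    (τ : ∀ i, Equiv.Perm (Fin (k i))) : Equiv.Perm (Fin (∑ i, k i)) :=
  (finSigmaFinEquiv (n := k)).symm.trans
    ((Equiv.sigmaCongr (β₂ := fun p : Fin n => Fin (k (σ.symm p))) σ
        fun i => (τ i).trans (finCongr (congrArg k (σ.symm_apply_apply i).symm))).trans
      ((finSigmaFinEquiv (n := fun p => k (σ.symm p))).trans
        (finCongr (Equiv.sum_comp σ.symm k))))

/-- The space `As(n) = 𝕜 Sₙ` of `n`-ary operations of the operad `As` of unital associative
algebras.  The right action of `σ ∈ Sₙ` is right multiplication by `σ` in the group algebra, and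
the element `1ₙ` is the unit of the group algebra. -/
abbrev As (𝕜 : Type u) [Field 𝕜] (n : ℕ) : Type u :=
  MonoidAlgebra 𝕜 (Equiv.Perm (Fin n))

/-- The composition `θ ∘ (θ₁, …, θₙ)` of `As`: the multilinear extension of
`σ ∘ (σ₁, …, σₙ) = ϑ_{n; k₁, …, kₙ}(σ, σ₁, …, σₙ)`. -/
noncomputable def comp {𝕜 : Type u} [Field 𝕜] {n : ℕ} {k : Fin n → ℕ}
    (θ : As 𝕜 n) (θs : ∀ i, As 𝕜 (k i)) : As 𝕜 (∑ i, k i) :=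
  ∑ σ : Equiv.Perm (Fin n), ∑ τ : (∀ i, Equiv.Perm (Fin (k i))),
    MonoidAlgebra.single (blockPerm σ τ) (θ.coeff σ * ∏ i, (θs i).coeff (τ i))

/-- `I = (I(n))_{n ≥ 0}` is an operadic ideal of `As`: every `I(n)` is an `Sₙ`-submodule of `As(n)`,
and `θ ∘ (θ₁, …, θₙ)` lies in `I` as soon as one of `θ, θ₁, …, θₙ` does. -/
structure IsOperadicIdeal {𝕜 : Type u} [Field 𝕜] (I : ∀ n, Submodule 𝕜 (As 𝕜 n)) : Prop where
  mul_perm_mem : ∀ (n : ℕ) (θ : As 𝕜 n) (σ : Equiv.Perm (Fin n)), θ ∈ I n →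
    θ * MonoidAlgebra.of 𝕜 (Equiv.Perm (Fin n)) σ ∈ I n
  comp_mem_left : ∀ (n : ℕ) (k : Fin n → ℕ) (θ : As 𝕜 n) (θs : ∀ i, As 𝕜 (k i)),
    θ ∈ I n → comp θ θs ∈ I (∑ i, k i)
  comp_mem_right : ∀ (n : ℕ) (k : Fin n → ℕ) (θ : As 𝕜 n) (θs : ∀ i, As 𝕜 (k i)) (s : Fin n),
    θs s ∈ I (k s) → comp θ θs ∈ I (∑ i, k i)

/-- The restriction operator `π^J(θ) = θ ∘ (1_{χ_J(1)}, …, 1_{χ_J(n)})` for `J ⊆ {1, …, n}`, where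
`χ_J` is the characteristic function of `J`.  Its target is `As(|J|)`, where `|J|` is kept in the
form `∑ i, χ_J(i)`. -/
noncomputable def restriction (𝕜 : Type u) [Field 𝕜] {n : ℕ} (J : Finset (Fin n)) :
    As 𝕜 n →ₗ[𝕜] As 𝕜 (∑ i, if i ∈ J then 1 else 0) where
  toFun θ := comp θ fun i => (1 : As 𝕜 (if i ∈ J then 1 else 0))
  map_add' x y := by
    simp only [comp, MonoidAlgebra.coeff_add, Finsupp.add_apply, add_mul,
      MonoidAlgebra.single_add, Finset.sum_add_distrib]
  map_smul' c x := by
    simp only [comp, MonoidAlgebra.coeff_smul, Finsupp.smul_apply, smul_eq_mul, mul_assoc,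
      Finset.smul_sum, MonoidAlgebra.smul_single, RingHom.id_apply]

/-- The `k`-th truncation `ᵏU` of `As`: `ᵏU(n)` is the intersection of the kernels of all `π^J` with
`J ⊆ {1, …, n}` and `|J| ≤ k - 1`.  (For `n < k` the set `J = {1, …, n}` is among these, and
`ᵏU(n) = 0`; for `n ≥ k ≥ 1` the sets `J` with `|J| = k - 1` suffice; and `⁰U = As`.) -/
noncomputable def truncation (𝕜 : Type u) [Field 𝕜] (k n : ℕ) : Submodule 𝕜 (As 𝕜 n) :=
  ⨅ (J : Finset (Fin n)) (_ : J.card < k), LinearMap.ker (restriction 𝕜 J)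

/-- The Gelfand–Kirillov dimension `limsup_{n → ∞} log_n (∑_{i=0}^n dim M(i))` of a sequence of
vector spaces.  It is an extended real number, with the convention `log 0 = -∞` and `log ∞ = ∞`. -/
noncomputable def gkDim (𝕜 : Type u) [Field 𝕜] (M : ℕ → Type v) [∀ n, AddCommGroup (M n)]
    [∀ n, Module 𝕜 (M n)] : EReal :=
  Filter.limsup (fun n : ℕ =>
    ENNReal.log (∑ i ∈ Finset.range (n + 1), ((Cardinal.toENat (Module.rank 𝕜 (M i)) : ℕ∞) : ENNReal))
      / ((Real.log (n : ℝ) : ℝ) : EReal)) Filter.atTop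

end AsOperad

namespace AsOperad

universe u v

/-! Elements of `As 𝕜 n` are treated as multilinear noncommutative polynomials. Evaluation in
algebras turns operadic composition into substitution (`eval_comp`) and is faithful on free
variables (`eval_ι_injective`). The truncation then consists of the polynomials vanishing whenever
fewer than `k` arguments differ from `1` (`mem_truncation_iff`).

Upper bound: the quotient by the truncation embeds in the product of the `As(|J|)` with `|J| < k`,
so its dimensions are `O(n^(k-1))` and their partial sums `O(n^k)`; larger ideals have smaller
quotients.

Converse: call an element proper if it dies when any one variable is set to `1`. A proper element of
arity `m` outside `I` yields `n.choose m` independent classes modulo `I` in arity `n`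
(`choose_le_finrank`), hence dimension at least `m + 1`. If the dimension is at most `k`, every
proper element of arity at least `k` lies in `I`. The truncation is zero below arity `k`, so all its
proper elements lie in `I`, and an ideal is controlled by its proper elements
(`le_of_isProper_mem`).

The exact value comes from nonzero proper elements of arity `k - 1`, namely left-normed commutators.
None exists in arity `1`, which explains the exception at `k = 2`. -/

theorem ofFn_finSigmaFinEquiv_symm {α : Type*} {n : ℕ} {k : Fin n → ℕ} (g : (Σ i, Fin (k i)) → α) :
    List.ofFn (fun j => g (finSigmaFinEquiv.symm j)) =
      (List.ofFn fun i => List.ofFn fun a => g ⟨i, a⟩).flatten := by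
  induction n with
  | zero => simp
  | succ n ih =>
    rw [List.ofFn_congr (Fin.sum_univ_castSucc k), List.ofFn_add, List.ofFn_succ',
      List.concat_eq_append, List.flatten_append]
    congr 1
    · rw [← ih fun x : (Σ i : Fin n, Fin (k i.castSucc)) => g ⟨x.1.castSucc, x.2⟩]
      congr 1
      funext j
      obtain ⟨⟨i, a⟩, rfl⟩ := finSigmaFinEquiv.surjective j
      rw [Equiv.symm_apply_apply]
      congr 1
      rw [Equiv.symm_apply_eq]
      ext
      simp [finSigmaFinEquiv_apply]
    · simp only [List.flatten_singleton]
      congr 1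
      funext j
      congr 1
      rw [Equiv.symm_apply_eq]
      ext
      simp [finSigmaFinEquiv_apply]
      rfl

/-- The word of a block permutation is the concatenation of the words of its blocks in the order
given by `σ`; this is what makes composition a substitution. -/
theorem ofFn_blockPerm_symm {α : Type*} {n : ℕ} {k : Fin n → ℕ} (g : (Σ i, Fin (k i)) → α)
    (σ : Equiv.Perm (Fin n)) (τ : ∀ i, Equiv.Perm (Fin (k i))) :
    List.ofFn (fun j => g (finSigmaFinEquiv.symm ((blockPerm σ τ).symm j))) =
      (List.ofFn fun p => List.ofFn fun a => g ⟨σ.symm p, (τ (σ.symm p)).symm a⟩).flatten := by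
  rw [List.ofFn_congr (Equiv.sum_comp σ.symm k).symm, ← ofFn_finSigmaFinEquiv_symm
    (fun x : (Σ p, Fin (k (σ.symm p))) => g ⟨σ.symm x.1, (τ (σ.symm x.1)).symm x.2⟩)]
  congr 1
  funext j
  congr 1
  obtain ⟨⟨p, a⟩, rfl⟩ := finSigmaFinEquiv.surjective j
  rw [Equiv.symm_apply_eq, Equiv.symm_apply_eq, Equiv.symm_apply_apply]
  have h : (Equiv.sigmaCongr (β₂ := fun p : Fin n => Fin (k (σ.symm p))) σ
      fun i => (τ i).trans (finCongr (congrArg k (σ.symm_apply_apply i).symm)))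
      ⟨σ.symm p, (τ (σ.symm p)).symm a⟩ = ⟨p, a⟩ := by
    refine Sigma.ext (σ.apply_symm_apply p) ?_
    refine (Fin.heq_ext_iff ?_).2 ?_
    · exact congrArg k (congrArg σ.symm (σ.apply_symm_apply p))
    · exact congrArg Fin.val ((τ (σ.symm p)).apply_symm_apply a)
  simp only [blockPerm, Equiv.trans_apply, Equiv.symm_apply_apply]
  rw [h]
  rfl

/-! ### Evaluation of multilinear polynomials -/

section eval

variable {𝕜 : Type u} [Field 𝕜] {A : Type*} [Ring A] [Algebra 𝕜 A]
  {B : Type*} [Ring B] [Algebra 𝕜 B] {n : ℕ}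

/-- Evaluation of an element of `As(n)`, seen as a multilinear noncommutative polynomial, at
elements of an algebra. -/
noncomputable def eval (f : Fin n → A) : As 𝕜 n →ₗ[𝕜] A where
  toFun θ := ∑ σ : Equiv.Perm (Fin n), θ.coeff σ • (List.ofFn fun j => f (σ.symm j)).prod
  map_add' x y := by simp [add_smul, Finset.sum_add_distrib]
  map_smul' c x := by simp [Finset.smul_sum, mul_smul]

theorem eval_apply (f : Fin n → A) (θ : As 𝕜 n) :
    eval f θ = ∑ σ : Equiv.Perm (Fin n), θ.coeff σ • (List.ofFn fun j => f (σ.symm j)).prod := rfl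

theorem eval_single (f : Fin n → A) (σ : Equiv.Perm (Fin n)) (c : 𝕜) :
    eval f (MonoidAlgebra.single σ c) = c • (List.ofFn fun j => f (σ.symm j)).prod := by
  rw [eval_apply, Finset.sum_eq_single σ]
  · simp
  · intro τ _ h
    simp [h.symm]
  · simp

theorem eval_one (f : Fin n → A) : eval f (1 : As 𝕜 n) = (List.ofFn f).prod := by
  rw [MonoidAlgebra.one_def, eval_single, one_smul]
  rfl

theorem eval_mul_of (f : Fin n → A) (θ : As 𝕜 n) (σ : Equiv.Perm (Fin n)) :
    eval f (θ * MonoidAlgebra.of 𝕜 _ σ) = eval (f ∘ σ.symm) θ := by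
  induction θ using MonoidAlgebra.induction_linear with
  | zero => simp
  | add x y hx hy => rw [add_mul, map_add, map_add, hx, hy]
  | single τ c =>
    simp only [MonoidAlgebra.of_apply, MonoidAlgebra.single_mul_single, mul_one, eval_single]
    rfl

theorem eval_eq_sum_mkPiAlgebraFin (f : Fin n → A) (θ : As 𝕜 n) :
    eval f θ = ∑ σ : Equiv.Perm (Fin n),
      θ.coeff σ • MultilinearMap.mkPiAlgebraFin 𝕜 n A (f ∘ σ.symm) := rfl

theorem map_eval (φ : A →ₐ[𝕜] B) (f : Fin n → A) (θ : As 𝕜 n) : φ (eval f θ) = eval (φ ∘ f) θ := by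
  simp only [eval_apply, map_sum, map_smul, map_list_prod, List.map_ofFn]
  rfl

theorem eval_smul (c : Fin n → 𝕜) (f : Fin n → A) (θ : As 𝕜 n) :
    eval (fun i => c i • f i) θ = (∏ i, c i) • eval f θ := by
  simp only [eval_eq_sum_mkPiAlgebraFin, Finset.smul_sum]
  refine Finset.sum_congr rfl fun σ _ => ?_
  have := (MultilinearMap.mkPiAlgebraFin 𝕜 n A).map_smul_univ (c ∘ σ.symm) (f ∘ σ.symm)
  rw [smul_comm, ← Equiv.prod_comp σ.symm c]
  exact congrArg _ this

theorem eval_eq_zero_of_apply_eq_zero {f : Fin n → A} {s : Fin n} (h : f s = 0) (θ : As 𝕜 n) :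
    eval f θ = 0 := by
  rw [eval_eq_sum_mkPiAlgebraFin]
  refine Finset.sum_eq_zero fun σ _ => ?_
  rw [(MultilinearMap.mkPiAlgebraFin 𝕜 n A).map_coord_zero (σ s) (by simp [h]), smul_zero]

theorem eval_of_comm {A : Type*} [CommRing A] [Algebra 𝕜 A] (f : Fin n → A) (θ : As 𝕜 n) :
    eval f θ = (∏ i, f i) * eval (fun _ => (1 : A)) θ := by
  simp only [eval_apply, List.prod_ofFn, Finset.mul_sum, Finset.prod_const_one]
  refine Finset.sum_congr rfl fun σ _ => ?_
  rw [Equiv.prod_comp σ.symm f, mul_smul_comm, mul_one]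

theorem eval_comp {k : Fin n → ℕ} (g : (Σ i, Fin (k i)) → A) (θ : As 𝕜 n) (θs : ∀ i, As 𝕜 (k i)) :
    eval (g ∘ finSigmaFinEquiv.symm) (comp θ θs) =
      eval (fun i => eval (fun a => g ⟨i, a⟩) (θs i)) θ := by
  simp only [comp, map_sum, eval_single]
  simp only [Function.comp_apply, ofFn_blockPerm_symm, List.prod_flatten, List.map_ofFn]
  rw [eval_eq_sum_mkPiAlgebraFin]
  refine Finset.sum_congr rfl fun σ _ => ?_
  have : ((fun i => eval (fun a => g ⟨i, a⟩) (θs i)) ∘ σ.symm : Fin n → A) = fun p =>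
      ∑ τ : Equiv.Perm (Fin (k (σ.symm p))), (θs (σ.symm p)).coeff τ •
        (List.ofFn fun a => g ⟨σ.symm p, τ.symm a⟩).prod := rfl
  rw [this, MultilinearMap.map_sum, Finset.smul_sum]
  -- Expanding the product indexes the inner permutations by position, whereas `comp` indexes them
  -- by argument; `σ` translates between the two.
  refine Fintype.sum_equiv (Equiv.piCongrLeft' (fun i => Equiv.Perm (Fin (k i))) σ) _ _ fun τ => ?_
  rw [MultilinearMap.map_smul_univ, smul_smul, ← Equiv.prod_comp σ.symm]
  rfl

theorem eval_comp' {k : Fin n → ℕ} (g : Fin (∑ i, k i) → A) (θ : As 𝕜 n) (θs : ∀ i, As 𝕜 (k i)) :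
    eval g (comp θ θs) = eval (fun i => eval (fun a => g (finSigmaFinEquiv ⟨i, a⟩)) (θs i)) θ := by
  rw [← eval_comp fun x => g (finSigmaFinEquiv x)]
  congr 1
  congr 1
  funext j
  simp

end eval

variable (𝕜 : Type u) [Field 𝕜]

theorem equivMonoidAlgebraFreeMonoid_prod_ι (l : List ℕ) :
    FreeAlgebra.equivMonoidAlgebraFreeMonoid ((l.map (FreeAlgebra.ι 𝕜)).prod) =
      MonoidAlgebra.single (FreeMonoid.ofList l) (1 : 𝕜) := by
  induction l with
  | nil => simp [MonoidAlgebra.one_def]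
  | cons a l ih =>
    rw [List.map_cons, List.prod_cons, map_mul, ih]
    simp [FreeAlgebra.equivMonoidAlgebraFreeMonoid, MonoidAlgebra.single_mul_single]

/-- Distinct permutations give distinct words, and words are a basis of the free algebra. -/
theorem eval_ι_injective {n : ℕ} {e : Fin n → ℕ} (he : Function.Injective e) :
    Function.Injective (eval (𝕜 := 𝕜) fun i => FreeAlgebra.ι 𝕜 (e i)) := by
  rw [← LinearMap.ker_eq_bot, LinearMap.ker_eq_bot']
  intro θ hθ
  have h := congrArg FreeAlgebra.equivMonoidAlgebraFreeMonoid hθ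
  have key (σ : Equiv.Perm (Fin n)) : FreeAlgebra.equivMonoidAlgebraFreeMonoid
      (List.ofFn fun j => FreeAlgebra.ι 𝕜 (e (σ.symm j))).prod =
      MonoidAlgebra.single (FreeMonoid.ofList (List.ofFn fun j => e (σ.symm j))) (1 : 𝕜) := by
    rw [← equivMonoidAlgebraFreeMonoid_prod_ι, List.map_ofFn]
    rfl
  rw [eval_apply, map_sum, map_zero] at h
  simp only [map_smul, key] at h
  ext σ
  have h' := congrArg (fun x => x.coeff (FreeMonoid.ofList (List.ofFn fun j => e (σ.symm j)))) h
  simp only [MonoidAlgebra.coeff_sum, Finsupp.finsetSum_apply] at h'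
  rw [Finset.sum_eq_single σ] at h'
  · simpa using h'
  · intro τ _ hτ
    rw [MonoidAlgebra.coeff_smul, Finsupp.smul_apply, MonoidAlgebra.coeff_single,
      Finsupp.single_eq_of_ne, smul_zero]
    intro heq
    refine hτ ?_
    have := List.ofFn_injective (FreeMonoid.ofList.injective heq)
    rw [← Equiv.symm_bijective.injective.eq_iff]
    ext j
    exact congrArg _ (he (congrFun this j)).symm
  · simp

/-! ### The truncations as ideals -/

section truncation

variable {𝕜 : Type u} [Field 𝕜] {n : ℕ}

/-- A substitution `f` factors through `π^J` with `J` the set of arguments different from `1`;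
conversely, free variables detect whether `π^J` kills `θ`. -/
theorem mem_truncation_iff {k : ℕ} {θ : As 𝕜 n} : θ ∈ truncation 𝕜 k n ↔
    ∀ f : Fin n → FreeAlgebra 𝕜 ℕ, {i | f i ≠ 1}.ncard < k → eval f θ = 0 := by
  classical
  simp only [truncation, Submodule.mem_iInf, LinearMap.mem_ker]
  constructor
  · intro h f hf
    have hJ := h (Finset.univ.filter fun i => f i ≠ 1) (by
      rw [← Set.ncard_coe_finset]
      simpa using hf)
    have := congrArg (eval fun j => f (finSigmaFinEquiv.symm j).1) hJ
    rw [map_zero] at this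
    rw [← this]
    simp only [restriction, LinearMap.coe_mk, AddHom.coe_mk]
    rw [eval_comp']
    congr 1
    congr 1
    funext i
    simp only [Equiv.symm_apply_apply, eval_one, List.ofFn_const, List.prod_replicate]
    by_cases hi : f i = 1 <;> simp [hi]
  · intro h J hJ
    apply eval_ι_injective 𝕜 Fin.val_injective
    rw [map_zero]
    simp only [restriction, LinearMap.coe_mk, AddHom.coe_mk]
    rw [eval_comp']
    apply h
    refine lt_of_le_of_lt ?_ hJ
    rw [← Set.ncard_coe_finset]
    refine Set.ncard_le_ncard fun i hi => ?_
    by_contra hiJ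
    refine hi ?_
    rw [eval_one, List.prod_eq_one]
    intro x hx
    obtain ⟨a, -⟩ := List.mem_ofFn.1 hx
    exact absurd a.2 (by simp [show i ∉ J from hiJ])

theorem truncation_eq_bot {k : ℕ} (h : n < k) : truncation 𝕜 k n = ⊥ := by
  rw [eq_bot_iff]
  intro θ hθ
  apply eval_ι_injective 𝕜 Fin.val_injective
  rw [map_zero]
  refine mem_truncation_iff.1 hθ _ (lt_of_le_of_lt (Set.ncard_le_card _) ?_)
  simpa using h

theorem eval_one_eq_algebraMap {A : Type*} [Ring A] [Algebra 𝕜 A] (θ : As 𝕜 n) :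
    eval (fun _ => (1 : A)) θ = algebraMap 𝕜 A (eval (fun _ => (1 : 𝕜)) θ) := by
  have := map_eval (Algebra.ofId 𝕜 A) (fun _ => (1 : 𝕜)) θ
  rw [Algebra.ofId_apply] at this
  rw [this]
  congr 1
  congr 1
  funext i
  simp

theorem isOperadicIdeal_truncation (k : ℕ) : IsOperadicIdeal (truncation 𝕜 k) where
  mul_perm_mem n θ σ hθ := by
    rw [mem_truncation_iff] at hθ ⊢
    intro f hf
    rw [eval_mul_of]
    refine hθ _ (lt_of_le_of_lt ?_ hf)
    exact Set.ncard_le_ncard_of_injOn σ.symm (fun i hi => hi) σ.symm.injective.injOn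
  comp_mem_left n κ θ θs hθ := by
    classical
    rw [mem_truncation_iff] at hθ ⊢
    intro f hf
    rw [eval_comp']
    set P : Fin n → Prop := fun i => ∀ a, f (finSigmaFinEquiv ⟨i, a⟩) = 1
    -- A block whose arguments are all `1` evaluates to a scalar. Pulling the scalar out leaves `1`
    -- there, so `θ` sees no more non-unit arguments than `f` has.
    have : (fun i => eval (fun a => f (finSigmaFinEquiv ⟨i, a⟩)) (θs i)) = fun i =>
        (if P i then eval (fun _ => (1 : 𝕜)) (θs i) else 1) •
          (if P i then 1 else eval (fun a => f (finSigmaFinEquiv ⟨i, a⟩)) (θs i)) := by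
      funext i
      split_ifs with h
      · rw [funext h, eval_one_eq_algebraMap, Algebra.algebraMap_eq_smul_one]
      · rw [one_smul]
    rw [this, eval_smul, hθ, smul_zero]
    refine lt_of_le_of_lt ?_ hf
    refine le_trans (Set.ncard_le_ncard ?_)
      (Set.ncard_image_le (f := fun j => (finSigmaFinEquiv.symm j).1))
    intro i hi
    have hP : ¬ P i := fun h => hi (if_pos h)
    simp only [P, not_forall] at hP
    obtain ⟨a, ha⟩ := hP
    exact ⟨_, ha, by simp⟩
  comp_mem_right n κ θ θs s hs := by
    rw [mem_truncation_iff] at hs ⊢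
    intro f hf
    rw [eval_comp']
    refine eval_eq_zero_of_apply_eq_zero (s := s) (hs _ (lt_of_le_of_lt ?_ hf)) θ
    refine Set.ncard_le_ncard_of_injOn (fun a => finSigmaFinEquiv ⟨s, a⟩) (fun i hi => hi) ?_
    intro a _ b _ h
    simpa using h

end truncation

/-! ### Ideals inside the free algebra -/

section onFinset

variable {𝕜 : Type u} [Field 𝕜]

/-- The multilinear noncommutative polynomials in the variables from `S` given by elements
of `I(|S|)`. -/
noncomputable def onFinset (I : ∀ n, Submodule 𝕜 (As 𝕜 n)) (S : Finset ℕ) :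
    Submodule 𝕜 (FreeAlgebra 𝕜 ℕ) :=
  (I S.card).map (eval fun i => FreeAlgebra.ι 𝕜 (S.orderEmbOfFin rfl i))

theorem isOperadicIdeal_top : IsOperadicIdeal (𝕜 := 𝕜) fun _ => ⊤ :=
  ⟨fun _ _ _ _ => trivial, fun _ _ _ _ _ => trivial, fun _ _ _ _ _ _ => trivial⟩

variable {I : ∀ n, Submodule 𝕜 (As 𝕜 n)}

theorem onFinset_le_top (S : Finset ℕ) : onFinset I S ≤ onFinset (fun _ => ⊤) S :=
  Submodule.map_mono le_top

/-- Two enumerations of `S` differ by a permutation, under which `I` is stable. -/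
theorem IsOperadicIdeal.mem_onFinset_iff (hI : IsOperadicIdeal I) {n : ℕ} {e : Fin n → ℕ}
    (he : Function.Injective e) {S : Finset ℕ} (hS : Set.range e = S) {p : FreeAlgebra 𝕜 ℕ} :
    p ∈ onFinset I S ↔ ∃ θ ∈ I n, eval (fun i => FreeAlgebra.ι 𝕜 (e i)) θ = p := by
  have hn : S.card = n := by
    rw [← Set.ncard_coe_finset, ← hS, ← Set.image_univ, Set.ncard_image_of_injective _ he]
    simp
  subst hn
  set e' := S.orderEmbOfFin rfl
  have hmem (i) : ∃ j, e' j = e i := by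
    have : e i ∈ Set.range e' := by
      rw [Finset.range_orderEmbOfFin, ← hS]
      exact ⟨i, rfl⟩
    exact this
  choose σ hσ using hmem
  have hσ' : Function.Bijective σ := by
    refine Function.Injective.bijective_of_finite fun i j h => he ?_
    rw [← hσ, ← hσ, h]
  set τ := Equiv.ofBijective σ hσ'
  have heq (θ : As 𝕜 S.card) : eval (fun i => FreeAlgebra.ι 𝕜 (e i)) θ =
      eval (fun i => FreeAlgebra.ι 𝕜 (e' i)) (θ * MonoidAlgebra.of 𝕜 _ τ⁻¹) := by
    rw [eval_mul_of]
    congr 1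
    congr 1
    funext i
    exact congrArg _ (hσ i).symm
  constructor
  · rintro ⟨θ, hθ, rfl⟩
    refine ⟨θ * MonoidAlgebra.of 𝕜 _ τ, hI.mul_perm_mem _ _ _ hθ, ?_⟩
    rw [heq, mul_assoc, ← map_mul, mul_inv_cancel, map_one, mul_one]
  · rintro ⟨θ, hθ, rfl⟩
    exact ⟨_, hI.mul_perm_mem _ _ _ hθ, (heq θ).symm⟩

theorem IsOperadicIdeal.eval_mem_onFinset_iff (hI : IsOperadicIdeal I) {n : ℕ} {e : Fin n → ℕ}
    (he : Function.Injective e) {S : Finset ℕ} (hS : Set.range e = S) {θ : As 𝕜 n} :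
    eval (fun i => FreeAlgebra.ι 𝕜 (e i)) θ ∈ onFinset I S ↔ θ ∈ I n := by
  rw [hI.mem_onFinset_iff he hS]
  exact (eval_ι_injective 𝕜 he).mem_set_image

/-- The substitution `xᵢ ↦ 1` for all `i` outside `J`. -/
noncomputable def setOne (𝕜 : Type u) [Field 𝕜] (J : Set ℕ) :
    FreeAlgebra 𝕜 ℕ →ₐ[𝕜] FreeAlgebra 𝕜 ℕ :=
  open Classical in FreeAlgebra.lift 𝕜 fun i => if i ∈ J then FreeAlgebra.ι 𝕜 i else 1

theorem setOne_ι_of_mem {J : Set ℕ} {i : ℕ} (h : i ∈ J) :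
    setOne 𝕜 J (FreeAlgebra.ι 𝕜 i) = FreeAlgebra.ι 𝕜 i := by
  simp [setOne, h]

theorem setOne_ι_of_notMem {J : Set ℕ} {i : ℕ} (h : i ∉ J) :
    setOne 𝕜 J (FreeAlgebra.ι 𝕜 i) = 1 := by
  simp [setOne, h]

theorem setOne_comm (J K : Set ℕ) (p : FreeAlgebra 𝕜 ℕ) :
    setOne 𝕜 J (setOne 𝕜 K p) = setOne 𝕜 K (setOne 𝕜 J p) := by
  have : (setOne 𝕜 J).comp (setOne 𝕜 K) = (setOne 𝕜 K).comp (setOne 𝕜 J) := by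
    ext i
    by_cases hJ : i ∈ J <;> by_cases hK : i ∈ K <;>
      simp [setOne_ι_of_mem, setOne_ι_of_notMem, hJ, hK]
  exact DFunLike.congr_fun this p

theorem setOne_idem (J : Set ℕ) (p : FreeAlgebra 𝕜 ℕ) :
    setOne 𝕜 J (setOne 𝕜 J p) = setOne 𝕜 J p := by
  have : (setOne 𝕜 J).comp (setOne 𝕜 J) = setOne 𝕜 J := by
    ext i
    by_cases hJ : i ∈ J <;> simp [setOne_ι_of_mem, setOne_ι_of_notMem, hJ]
  exact DFunLike.congr_fun this p

/-- Setting variables to `1` is composition with units of arity `0` or `1`. -/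
theorem IsOperadicIdeal.setOne_mem_onFinset (hI : IsOperadicIdeal I) {J : Set ℕ} {S T : Finset ℕ}
    (hT : ∀ i, i ∈ T ↔ i ∈ S ∧ i ∈ J) {p : FreeAlgebra 𝕜 ℕ} (hp : p ∈ onFinset I S) :
    setOne 𝕜 J p ∈ onFinset I T := by
  classical
  obtain ⟨θ, hθ, rfl⟩ := hp
  set e := S.orderEmbOfFin rfl
  let κ : Fin S.card → ℕ := fun i => if e i ∈ J then 1 else 0
  have hκ (i) (a : Fin (κ i)) : e i ∈ J := by
    by_contra h
    have := a.2
    simp only [κ, if_neg h] at this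
    omega
  have hcomp := hI.comp_mem_left _ κ θ (fun _ => 1) hθ
  have he : Function.Injective fun j : Fin (∑ i, κ i) => e (finSigmaFinEquiv.symm j).1 := by
    intro j₁ j₂ h
    obtain ⟨⟨i₁, a₁⟩, rfl⟩ := finSigmaFinEquiv.surjective j₁
    obtain ⟨⟨i₂, a₂⟩, rfl⟩ := finSigmaFinEquiv.surjective j₂
    simp only [Equiv.symm_apply_apply, EmbeddingLike.apply_eq_iff_eq] at h
    subst h
    have h₁ := a₁.2
    have h₂ := a₂.2
    have h₃ : κ i₁ ≤ 1 := by
      simp only [κ]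
      split_ifs <;> simp
    have : a₁ = a₂ := by
      ext
      omega
    rw [this]
  rw [← hI.eval_mem_onFinset_iff (S := T) he] at hcomp
  · convert hcomp using 1
    rw [map_eval, eval_comp']
    congr 1
    congr 1
    funext i
    simp only [Equiv.symm_apply_apply, eval_one, List.ofFn_const, List.prod_replicate,
      Function.comp_apply, κ]
    split_ifs with h
    · rw [setOne_ι_of_mem h, pow_one]
    · rw [setOne_ι_of_notMem h, pow_zero]
  · ext x
    rw [Set.mem_range, Finset.mem_coe, hT]
    constructor
    · rintro ⟨j, rfl⟩
      obtain ⟨⟨i, a⟩, rfl⟩ := finSigmaFinEquiv.surjective j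
      rw [Equiv.symm_apply_apply]
      exact ⟨Finset.orderEmbOfFin_mem _ _ _, hκ i a⟩
    · rintro ⟨hx, hJ⟩
      rw [← Finset.mem_coe, ← Finset.range_orderEmbOfFin S rfl] at hx
      obtain ⟨i, rfl⟩ := hx
      exact ⟨finSigmaFinEquiv ⟨i, ⟨0, by simp [κ, e, hJ]⟩⟩, by simp [e]⟩

/-- A product in disjoint variables is the composition of the binary unit `1₂` with the two factors.
-/
theorem IsOperadicIdeal.mul_mem_onFinset_aux (hI : IsOperadicIdeal I) (S : Fin 2 → Finset ℕ)
    (hS : Disjoint (S 0) (S 1)) (p : Fin 2 → FreeAlgebra 𝕜 ℕ)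
    (hp : ∀ i, p i ∈ onFinset (fun _ => ⊤) (S i)) (s : Fin 2) (hs : p s ∈ onFinset I (S s)) :
    p 0 * p 1 ∈ onFinset I (S 0 ∪ S 1) := by
  choose θ _ hθ using hp
  have hdisj : ∀ i j, ∀ x ∈ S i, x ∈ S j → i = j := by
    have h₀₁ : ∀ x ∈ S 0, x ∉ S 1 := Finset.disjoint_left.1 hS
    intro i j x hi hj
    fin_cases i <;> fin_cases j
    · rfl
    · exact absurd hj (h₀₁ x hi)
    · exact absurd hi (h₀₁ x hj)
    · rfl
  have hs' : θ s ∈ I (S s).card := by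
    rwa [← hθ, hI.eval_mem_onFinset_iff ((S s).orderEmbOfFin rfl).injective (by simp)] at hs
  have hcomp := hI.comp_mem_right 2 (fun i => (S i).card) 1 θ s hs'
  let g : (Σ i, Fin (S i).card) → ℕ := fun x => (S x.1).orderEmbOfFin rfl x.2
  have hg : Function.Injective g := by
    rintro ⟨i₁, a₁⟩ ⟨i₂, a₂⟩ h
    simp only [g] at h
    have h₂ := Finset.orderEmbOfFin_mem (S i₂) rfl a₂
    rw [← h] at h₂
    obtain rfl := hdisj i₁ i₂ _ (Finset.orderEmbOfFin_mem _ rfl a₁) h₂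
    rw [EmbeddingLike.apply_eq_iff_eq] at h
    rw [h]
  have hr : Set.range (g ∘ finSigmaFinEquiv.symm) = (S 0 ∪ S 1 : Finset ℕ) := by
    rw [EquivLike.range_comp]
    ext x
    simp only [Set.mem_range, Finset.coe_union, Set.mem_union, Finset.mem_coe]
    constructor
    · rintro ⟨⟨i, a⟩, rfl⟩
      have := Finset.orderEmbOfFin_mem (S i) rfl a
      fin_cases i
      · exact Or.inl this
      · exact Or.inr this
    · intro h
      have : ∃ i, x ∈ S i := h.elim (fun h => ⟨0, h⟩) fun h => ⟨1, h⟩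
      obtain ⟨i, hi⟩ := this
      rw [← Finset.mem_coe, ← Finset.range_orderEmbOfFin (S i) rfl] at hi
      obtain ⟨a, rfl⟩ := hi
      exact ⟨⟨i, a⟩, rfl⟩
  rw [← hI.eval_mem_onFinset_iff (hg.comp finSigmaFinEquiv.symm.injective) hr] at hcomp
  convert hcomp using 1
  refine Eq.trans ?_ (eval_comp (fun x => FreeAlgebra.ι 𝕜 (g x)) 1 θ).symm
  simp only [g, hθ, eval_one]
  simp [List.ofFn_succ]

theorem IsOperadicIdeal.mul_mem_onFinset_left (hI : IsOperadicIdeal I) {S T : Finset ℕ}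
    (hST : Disjoint S T) {p q : FreeAlgebra 𝕜 ℕ} (hp : p ∈ onFinset (fun _ => ⊤) S)
    (hq : q ∈ onFinset I T) : p * q ∈ onFinset I (S ∪ T) :=
  hI.mul_mem_onFinset_aux ![S, T] hST ![p, q]
    (Fin.forall_fin_two.2 ⟨hp, onFinset_le_top _ hq⟩) 1 hq

theorem ι_mem_onFinset_top (i : ℕ) : FreeAlgebra.ι 𝕜 i ∈ onFinset (𝕜 := 𝕜) (fun _ => ⊤) {i} := by
  have := (isOperadicIdeal_top (𝕜 := 𝕜)).eval_mem_onFinset_iff (n := 1) (e := fun _ => i)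
    (Function.injective_of_subsingleton _) (S := {i}) (by simp) (θ := 1)
  simpa [eval_one] using this

theorem prod_ι_mem_onFinset_top (l : List ℕ) (hl : l.Nodup) :
    (l.map (FreeAlgebra.ι 𝕜)).prod ∈ onFinset (𝕜 := 𝕜) (fun _ => ⊤) l.toFinset := by
  induction l with
  | nil =>
    have := (isOperadicIdeal_top (𝕜 := 𝕜)).eval_mem_onFinset_iff (n := 0) (e := Fin.elim0)
      (Function.injective_of_subsingleton _) (S := ∅) (by simp) (θ := 1)
    simpa [eval_one] using this
  | cons a l ih =>
    rw [List.nodup_cons] at hl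
    rw [List.map_cons, List.prod_cons, List.toFinset_cons, Finset.insert_eq]
    exact isOperadicIdeal_top.mul_mem_onFinset_left (by simpa using hl.1) (ι_mem_onFinset_top a)
      (ih hl.2)

end onFinset

/-! ### Reduction to proper elements -/

section proper

variable {𝕜 : Type u} [Field 𝕜]

/-- An element of `As(n)` is proper if it vanishes when `1` is substituted for a variable. -/
def IsProper {n : ℕ} (θ : As 𝕜 n) : Prop :=
  ∀ f : Fin n → FreeAlgebra 𝕜 ℕ, (∃ i, f i = 1) → eval f θ = 0

/-- By freeness, any substitution with `f i = 1` factors through setting the single variable `e i`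
to `1`. -/
theorem isProper_of_setOne_eq_zero {n : ℕ} {θ : As 𝕜 n} {e : Fin n → ℕ} (he : Function.Injective e)
    (h : ∀ i, setOne 𝕜 {e i}ᶜ (eval (fun i => FreeAlgebra.ι 𝕜 (e i)) θ) = 0) : IsProper θ := by
  rintro f ⟨i, hi⟩
  have := congrArg (FreeAlgebra.lift 𝕜 (Function.extend e f 0)) (h i)
  rw [map_eval, map_eval, map_zero] at this
  rw [← this]
  congr 1
  congr 1
  funext j
  by_cases hj : j = i
  · subst hj
    simp [setOne_ι_of_notMem, hi]
  · simp [setOne_ι_of_mem, he.eq_iff, hj, he.extend_apply]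

theorem IsOperadicIdeal.le_of_isProper_mem {I U : ∀ n, Submodule 𝕜 (As 𝕜 n)}
    (hI : IsOperadicIdeal I) (hU : IsOperadicIdeal U)
    (h : ∀ n, ∀ θ ∈ U n, IsProper θ → θ ∈ I n) (n : ℕ) : U n ≤ I n := by
  have key (S : Finset ℕ) : onFinset U S ≤ onFinset I S := by
    induction S using Finset.strongInduction with
    | H S ih =>
      intro p hp
      -- Replacing `q` by `q - xᵢ · q|_{xᵢ = 1}` makes it vanish at `xᵢ = 1` and keeps the
      -- vanishings already achieved. The subtracted term is in `I`, since `q|_{xᵢ = 1}` involves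
      -- fewer variables.
      have step (T : Finset ℕ) (hT : T ⊆ S) : ∃ q ∈ onFinset U S, p - q ∈ onFinset I S ∧
          ∀ i ∈ T, setOne 𝕜 {i}ᶜ q = 0 := by
        induction T using Finset.induction_on with
        | empty => exact ⟨p, hp, by simp, by simp⟩
        | insert i T hi ihT =>
          obtain ⟨q, hq, hpq, hqT⟩ := ihT ((Finset.subset_insert _ _).trans hT)
          have hiS : i ∈ S := hT (Finset.mem_insert_self _ _)
          have hδ : setOne 𝕜 {i}ᶜ q ∈ onFinset U (S.erase i) :=
             hU.setOne_mem_onFinset (by simp [and_comm]) hq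
          have hx {K : ∀ n, Submodule 𝕜 (As 𝕜 n)} (hK : IsOperadicIdeal K)
              (h : setOne 𝕜 {i}ᶜ q ∈ onFinset K (S.erase i)) :
              FreeAlgebra.ι 𝕜 i * setOne 𝕜 {i}ᶜ q ∈ onFinset K S := by
            have := hK.mul_mem_onFinset_left (by simp) (ι_mem_onFinset_top i) h
            rwa [← Finset.insert_eq, Finset.insert_erase hiS] at this
          refine ⟨q - FreeAlgebra.ι 𝕜 i * setOne 𝕜 {i}ᶜ q, sub_mem hq (hx hU hδ), ?_, ?_⟩
          · rw [← sub_add]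
            exact add_mem hpq (hx hI (ih _ (Finset.erase_ssubset hiS) hδ))
          · intro j hj
            rw [map_sub, map_mul]
            rcases Finset.mem_insert.1 hj with rfl | hj
            · rw [setOne_idem, setOne_ι_of_notMem (by simp), one_mul, sub_self]
            · rw [setOne_comm, hqT j hj, map_zero, mul_zero, sub_zero]
      obtain ⟨q, ⟨θ, hθ, rfl⟩, hpq, hqS⟩ := step S subset_rfl
      rw [← sub_add_cancel p (eval _ θ)]
      refine add_mem hpq ⟨θ, h _ θ hθ ?_, rfl⟩
      exact isProper_of_setOne_eq_zero (S.orderEmbOfFin rfl).injective fun i =>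
        hqS _ (Finset.orderEmbOfFin_mem _ _ _)
  intro θ hθ
  have hr : Set.range (Fin.val : Fin n → ℕ) = (Finset.range n : Finset ℕ) := by
    ext
    simp
  rw [← hI.eval_mem_onFinset_iff Fin.val_injective hr]
  exact key _ ((hU.eval_mem_onFinset_iff Fin.val_injective hr).2 hθ)

end proper

/-! ### Dimension bounds for quotients -/

section rank

variable {𝕜 : Type u} [Field 𝕜]

instance finite_As (n : ℕ) : Module.Finite 𝕜 (As 𝕜 n) :=
  Module.Finite.equiv (MonoidAlgebra.coeffLinearEquiv 𝕜).symm

theorem finrank_As (n : ℕ) : Module.finrank 𝕜 (As 𝕜 n) = n.factorial := by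
  rw [(MonoidAlgebra.coeffLinearEquiv 𝕜).finrank_eq, Module.finrank_finsupp_self,
    Fintype.card_perm, Fintype.card_fin]

theorem IsOperadicIdeal.choose_le_finrank {I : ∀ n, Submodule 𝕜 (As 𝕜 n)} (hI : IsOperadicIdeal I)
    {m : ℕ} {θ : As 𝕜 m} (hθ : IsProper θ) (hθI : θ ∉ I m) (n : ℕ) :
    n.choose m ≤ Module.finrank 𝕜 (As 𝕜 n ⧸ I n) := by
  classical
  have hr : Set.range (Fin.val : Fin n → ℕ) = (Finset.range n : Finset ℕ) := by
    ext
    simp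
  let p (J : Finset.powersetCard m (Finset.range n)) : FreeAlgebra 𝕜 ℕ :=
    eval (fun i => FreeAlgebra.ι 𝕜 (J.1.orderEmbOfFin (Finset.mem_powersetCard.1 J.2).2 i)) θ
  let r (J : Finset.powersetCard m (Finset.range n)) : FreeAlgebra 𝕜 ℕ :=
    ((Finset.range n \ J.1).toList.map (FreeAlgebra.ι 𝕜)).prod
  have hpr (J : Finset.powersetCard m (Finset.range n)) :
      ∃ φ : As 𝕜 n, eval (fun i => FreeAlgebra.ι 𝕜 (i : ℕ)) φ = r J * p J := by
    have hp : p J ∈ onFinset (fun _ => ⊤) J.1 :=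
      (isOperadicIdeal_top.eval_mem_onFinset_iff (RelEmbedding.injective _) (by simp)).2
        Submodule.mem_top
    have hr' : r J ∈ onFinset (fun _ => ⊤) (Finset.range n \ J.1) := by
      simpa using prod_ι_mem_onFinset_top (𝕜 := 𝕜) _ (Finset.range n \ J.1).nodup_toList
    have := isOperadicIdeal_top.mul_mem_onFinset_left Finset.sdiff_disjoint hr' hp
    rw [Finset.sdiff_union_of_subset (Finset.mem_powersetCard.1 J.2).1,
      isOperadicIdeal_top.mem_onFinset_iff Fin.val_injective hr] at this
    simpa using this
  choose φ hφ using hpr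
  have hli : LinearIndependent 𝕜 fun J => (I n).mkQ (φ J) := by
    rw [Fintype.linearIndependent_iff]
    intro a ha J₀
    simp only [← map_smul, ← map_sum] at ha
    rw [Submodule.mkQ_apply, Submodule.Quotient.mk_eq_zero,
      ← hI.eval_mem_onFinset_iff Fin.val_injective hr] at ha
    have hJ₀ := Finset.mem_powersetCard.1 J₀.2
    -- Setting the variables outside `J₀` to `1` kills the terms with `J ≠ J₀` by properness and
    -- reduces the `J₀` term to a multiple of `θ`.
    have h := hI.setOne_mem_onFinset (J := J₀.1) (T := J₀.1)
      (fun i => ⟨fun hi => ⟨hJ₀.1 hi, hi⟩, And.right⟩) ha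
    simp only [map_sum, map_smul, hφ, map_mul] at h
    rw [Finset.sum_eq_single J₀] at h
    · have hr₁ : setOne 𝕜 (J₀.1 : Set ℕ) (r J₀) = 1 := by
        rw [map_list_prod, List.prod_eq_one]
        intro x hx
        simp only [List.mem_map, Finset.mem_toList, Finset.mem_sdiff] at hx
        obtain ⟨_, ⟨i, hi, rfl⟩, rfl⟩ := hx
        exact setOne_ι_of_notMem hi.2
      have hp₁ : setOne 𝕜 (J₀.1 : Set ℕ) (p J₀) = p J₀ := by
        rw [map_eval]
        congr 1
        congr 1
        funext i
        exact setOne_ι_of_mem (Finset.orderEmbOfFin_mem _ _ _)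
      rw [hr₁, hp₁, one_mul] at h
      by_contra ha₀
      rw [Submodule.smul_mem_iff _ ha₀] at h
      exact hθI ((hI.eval_mem_onFinset_iff (RelEmbedding.injective _) (by simp)).1 h)
    · intro J _ hJ
      have : ∃ i ∈ J.1, i ∉ J₀.1 := by
        by_contra! hsub
        refine hJ (Subtype.ext (Finset.eq_of_subset_of_card_le hsub ?_))
        rw [hJ₀.2, (Finset.mem_powersetCard.1 J.2).2]
      obtain ⟨i, hi, hi₀⟩ := this
      rw [← Finset.mem_coe,
        ← Finset.range_orderEmbOfFin J.1 (Finset.mem_powersetCard.1 J.2).2] at hi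
      obtain ⟨j, rfl⟩ := hi
      have : setOne 𝕜 (J₀.1 : Set ℕ) (p J) = 0 := by
        rw [map_eval]
        exact hθ _ ⟨j, setOne_ι_of_notMem hi₀⟩
      rw [this, mul_zero, smul_zero]
    · simp
  have := hli.fintype_card_le_finrank
  simpa using this

/-- There are at most `k * N ^ (k - 1)` sets `J` with fewer than `k` elements, each contributing at
most `k!`. The bound uses `N` so that it is uniform over `n ≤ N`. -/
theorem finrank_quotient_truncation_le {k n N : ℕ} (hN : 1 ≤ N) (hn : n ≤ N) :
    Module.finrank 𝕜 (As 𝕜 n ⧸ truncation 𝕜 k n) ≤ k * N ^ (k - 1) * k.factorial := by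
  classical
  let Φ : As 𝕜 n →ₗ[𝕜] ∀ J : {J : Finset (Fin n) // J.card < k},
      As 𝕜 (∑ i, if i ∈ J.1 then 1 else 0) :=
    LinearMap.pi fun J => restriction 𝕜 J.1
  have hker : truncation 𝕜 k n = LinearMap.ker Φ := by
    rw [LinearMap.ker_pi, truncation, iInf_subtype']
  rw [hker, Φ.quotKerEquivRange.finrank_eq]
  refine (Submodule.finrank_le _).trans ?_
  rw [Module.finrank_pi_fintype]
  refine (Finset.sum_le_card_nsmul _ _ k.factorial fun J _ => ?_).trans ?_
  · rw [finrank_As]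
    refine Nat.factorial_le ?_
    simpa using J.2.le
  · rw [smul_eq_mul]
    refine Nat.mul_le_mul_right _ ?_
    rw [Finset.card_univ, Fintype.card_subtype]
    have : (Finset.univ.filter fun J : Finset (Fin n) => J.card < k) ⊆
        (Finset.range k).biUnion fun j => Finset.univ.powersetCard j := by
      intro J
      simp
    refine (Finset.card_le_card this).trans (Finset.card_biUnion_le.trans ?_)
    refine (Finset.sum_le_card_nsmul _ _ (N ^ (k - 1)) fun j hj => ?_).trans (by simp)
    rw [Finset.card_powersetCard, Finset.card_univ, Fintype.card_fin]
    refine (Nat.choose_le_pow _ _).trans ((Nat.pow_le_pow_left hn _).trans ?_)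
    exact Nat.pow_le_pow_right hN (by rw [Finset.mem_range] at hj; omega)

end rank

/-! ### Polynomial growth and the Gelfand–Kirillov dimension -/

section gkDim

open Filter Topology

theorem tendsto_log_const_mul_pow_div_log {c : ℝ} (hc : 0 < c) (d : ℕ) :
    Tendsto (fun n : ℕ => ENNReal.log (ENNReal.ofReal (c * (n : ℝ) ^ d)) /
      ((Real.log (n : ℝ) : ℝ) : EReal)) atTop (𝓝 (d : EReal)) := by
  have hlog : Tendsto (fun n : ℕ => Real.log (n : ℝ)) atTop atTop :=
    Real.tendsto_log_atTop.comp tendsto_natCast_atTop_atTop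
  have h : Tendsto (fun n : ℕ => Real.log c / Real.log (n : ℝ) + d) atTop (𝓝 (0 + d)) :=
    (hlog.const_div_atTop _).add_const _
  rw [zero_add] at h
  have h' := (continuous_coe_real_ereal.tendsto (d : ℝ)).comp h
  refine Tendsto.congr' ?_ h'
  filter_upwards [eventually_ge_atTop 2] with n hn
  have hn0 : (0 : ℝ) < n := by positivity
  have hl : Real.log n ≠ 0 := (Real.log_pos (by exact_mod_cast hn)).ne'
  rw [ENNReal.log_ofReal_of_pos (by positivity), ← EReal.coe_div, Function.comp_apply,
    Real.log_mul hc.ne' (by positivity), Real.log_pow]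
  congr 1
  field_simp

variable {𝕜 : Type u} [Field 𝕜] {M : ℕ → Type v} [∀ n, AddCommGroup (M n)] [∀ n, Module 𝕜 (M n)]
  [∀ n, Module.Finite 𝕜 (M n)]

theorem sum_toENat_rank (n : ℕ) :
    ∑ i ∈ Finset.range (n + 1), ((Cardinal.toENat (Module.rank 𝕜 (M i)) : ℕ∞) : ENNReal) =
      ENNReal.ofReal ((∑ i ∈ Finset.range (n + 1), Module.finrank 𝕜 (M i) : ℕ) : ℝ) := by
  rw [ENNReal.ofReal_natCast]
  simp [← Module.finrank_eq_rank]

theorem gkDim_le_of_sum_finrank_le (c d : ℕ)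
    (h : ∀ᶠ n : ℕ in atTop, ∑ i ∈ Finset.range (n + 1), Module.finrank 𝕜 (M i) ≤ c * n ^ d) :
    gkDim 𝕜 M ≤ d := by
  -- The constant `c + 1` is positive even when `c = 0`.
  rw [← (tendsto_log_const_mul_pow_div_log (c := c + 1) (by positivity) d).limsup_eq]
  refine limsup_le_limsup ?_
  filter_upwards [h] with n hn
  rw [sum_toENat_rank]
  refine EReal.div_le_div_right_of_nonneg (by exact_mod_cast Real.log_natCast_nonneg n) ?_
  refine ENNReal.log_le_log (ENNReal.ofReal_le_ofReal ?_)
  refine (Nat.cast_le.2 hn).trans ?_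
  push_cast
  gcongr
  simp

theorem le_gkDim_of_pow_le {c : ℝ} (hc : 0 < c) (d : ℕ)
    (h : ∀ᶠ n : ℕ in atTop, c * (n : ℝ) ^ d ≤
      (∑ i ∈ Finset.range (n + 1), Module.finrank 𝕜 (M i) : ℕ)) :
    d ≤ gkDim 𝕜 M := by
  rw [← (tendsto_log_const_mul_pow_div_log hc d).limsup_eq]
  refine limsup_le_limsup ?_
  filter_upwards [h] with n hn
  rw [sum_toENat_rank]
  refine EReal.div_le_div_right_of_nonneg (by exact_mod_cast Real.log_natCast_nonneg n) ?_
  exact ENNReal.log_le_log (ENNReal.ofReal_le_ofReal hn)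

theorem succ_le_gkDim_of_choose_le (m : ℕ) (h : ∀ n, n.choose m ≤ Module.finrank 𝕜 (M n)) :
    ((m + 1 : ℕ) : EReal) ≤ gkDim 𝕜 M := by
  -- Summing the binomials gives `(n + 1).choose (m + 1)`, which is at least `(n + 1 - m) ^ (m + 1)
  -- / (m + 1)!`; the powers of `2` come from `n + 1 - m ≥ n / 2` for `n ≥ 2 * m`.
  refine le_gkDim_of_pow_le (c := 1 / (2 ^ (m + 1) * (m + 1).factorial)) (by positivity) _ ?_
  filter_upwards [eventually_ge_atTop (2 * m)] with n hn
  have h₁ : (n + 1).choose (m + 1) ≤ ∑ i ∈ Finset.range (n + 1), Module.finrank 𝕜 (M i) := by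
    rw [← Nat.sum_Icc_choose]
    refine (Finset.sum_le_sum_of_subset fun i hi => ?_).trans (Finset.sum_le_sum fun i _ => h i)
    rw [Finset.mem_Icc] at hi
    rw [Finset.mem_range]
    omega
  refine le_trans ?_ (Nat.cast_le.2 h₁)
  refine le_trans ?_ (Nat.pow_le_choose (m + 1) (n + 1))
  have h₂ : (n : ℝ) / 2 ≤ (n + 1 + 1 - (m + 1) : ℕ) := by
    rw [div_le_iff₀ two_pos]
    exact_mod_cast (by omega)
  calc _ = ((n : ℝ) / 2) ^ (m + 1) / (m + 1).factorial := by
        rw [div_pow]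
        field_simp
    _ ≤ _ := by gcongr

end gkDim

/-! ### Nonzero proper elements -/

section commutator

variable (𝕜 : Type u) [Field 𝕜]

/-- The left-normed commutator `[…[[x₀, x₁], x₂], …, xₘ]`. -/
noncomputable def leftNormedCommutator : ℕ → FreeAlgebra 𝕜 ℕ
  | 0 => FreeAlgebra.ι 𝕜 0
  | m + 1 => leftNormedCommutator m * FreeAlgebra.ι 𝕜 (m + 1) -
      FreeAlgebra.ι 𝕜 (m + 1) * leftNormedCommutator m

theorem leftNormedCommutator_mem_onFinset_top (m : ℕ) :
    leftNormedCommutator 𝕜 m ∈ onFinset (𝕜 := 𝕜) (fun _ => ⊤) (Finset.range (m + 1)) := by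
  induction m with
  | zero => exact ι_mem_onFinset_top 0
  | succ m ih =>
    have hx := ι_mem_onFinset_top (𝕜 := 𝕜) (m + 1)
    rw [Finset.range_add_one, Finset.insert_eq]
    refine sub_mem ?_ (isOperadicIdeal_top.mul_mem_onFinset_left (by simp) hx ih)
    rw [Finset.union_comm]
    exact isOperadicIdeal_top.mul_mem_onFinset_left (by simp) ih hx

theorem leftNormedCommutator_ne_zero (m : ℕ) : leftNormedCommutator 𝕜 m ≠ 0 := by
  let φ : FreeAlgebra 𝕜 ℕ →ₐ[𝕜] Matrix (Fin 2) (Fin 2) 𝕜 :=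
    -- With `x₀ ↦ E₁₂` and every other variable sent to `E₂₂`, bracketing with `E₂₂` on the right
    -- fixes `E₁₂`.
    FreeAlgebra.lift 𝕜 fun i => if i = 0 then !![0, 1; 0, 0] else !![0, 0; 0, 1]
  have h : φ (leftNormedCommutator 𝕜 m) = !![0, 1; 0, 0] := by
    induction m with
    | zero => simp [leftNormedCommutator, φ]
    | succ m ih => simp [leftNormedCommutator, ih, φ]
  intro h0
  rw [h0, map_zero] at h
  simpa using congrFun₂ h 0 1

theorem setOne_leftNormedCommutator {m i : ℕ} (hi : i ≤ m + 1) :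
    setOne 𝕜 {i}ᶜ (leftNormedCommutator 𝕜 (m + 1)) = 0 := by
  rw [leftNormedCommutator, map_sub, map_mul, map_mul]
  rcases hi.eq_or_lt with rfl | hi
  · rw [setOne_ι_of_notMem (by simp), mul_one, one_mul, sub_self]
  · cases m with
    | zero =>
      obtain rfl : i = 0 := by omega
      rw [leftNormedCommutator, setOne_ι_of_notMem (i := 0) (by simp), mul_one, one_mul, sub_self]
    | succ m => rw [setOne_leftNormedCommutator (by omega), zero_mul, mul_zero, sub_self]

theorem exists_isProper_ne_zero {m : ℕ} (hm : m ≠ 1) : ∃ θ : As 𝕜 m, IsProper θ ∧ θ ≠ 0 := by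
  match m with
  -- In arity `0` properness is vacuous.
  | 0 => exact ⟨1, fun f ⟨i, _⟩ => i.elim0, one_ne_zero⟩
  | m + 2 =>
    obtain ⟨θ, -, hθ⟩ := (isOperadicIdeal_top.mem_onFinset_iff (n := m + 2) Fin.val_injective
      (by ext; simp [Nat.lt_succ_iff])).1 (leftNormedCommutator_mem_onFinset_top 𝕜 (m + 1))
    refine ⟨θ, isProper_of_setOne_eq_zero Fin.val_injective fun i => ?_, ?_⟩
    · rw [hθ, setOne_leftNormedCommutator]
      omega
    · rintro rfl
      exact leftNormedCommutator_ne_zero 𝕜 (m + 1) (by rw [← hθ, map_zero])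

end commutator

/-! ### Comparison of ideals with truncations -/

section main

variable {𝕜 : Type u} [Field 𝕜] {I : ∀ n, Submodule 𝕜 (As 𝕜 n)}

theorem gkDim_quotient_le_of_truncation_le {k : ℕ} (hk : 1 ≤ k)
    (h : ∀ n, truncation 𝕜 k n ≤ I n) : gkDim 𝕜 (fun n => As 𝕜 n ⧸ I n) ≤ k := by
  refine gkDim_le_of_sum_finrank_le (2 * (k * k.factorial)) k ?_
  filter_upwards [Filter.eventually_ge_atTop 1] with N hN
  refine (Finset.sum_le_card_nsmul _ _ (k * N ^ (k - 1) * k.factorial) fun n hn => ?_).trans ?_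
  · refine (LinearMap.finrank_le_finrank_of_surjective (Submodule.factor_surjective (h n))).trans ?_
    exact finrank_quotient_truncation_le hN (by simpa [Nat.lt_succ_iff] using hn)
  · obtain ⟨d, rfl⟩ := Nat.exists_eq_add_of_le' hk
    rw [Finset.card_range, smul_eq_mul, Nat.add_sub_cancel]
    -- Uses `N + 1 ≤ 2 * N`, the source of the factor `2` in the constant.
    calc _ ≤ (N + N) * ((d + 1) * N ^ d * (d + 1).factorial) := by gcongr
      _ = _ := by ring

theorem IsOperadicIdeal.truncation_le_of_gkDim_le (hI : IsOperadicIdeal I) {k : ℕ}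
    (h : gkDim 𝕜 (fun n => As 𝕜 n ⧸ I n) ≤ k) (n : ℕ) : truncation 𝕜 k n ≤ I n := by
  refine hI.le_of_isProper_mem (isOperadicIdeal_truncation k) (fun m θ hθ hproper => ?_) n
  by_contra hθI
  have hkm : k ≤ m := by
    by_contra! hmk
    rw [truncation_eq_bot hmk, Submodule.mem_bot] at hθ
    exact hθI (hθ ▸ zero_mem _)
  have := (succ_le_gkDim_of_choose_le m (hI.choose_le_finrank hproper hθI)).trans h
  have : m + 1 ≤ k := by exact_mod_cast this
  omega

theorem succ_le_gkDim_quotient_truncation {k m : ℕ} (hmk : m < k) (hm : m ≠ 1) :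
    ((m + 1 : ℕ) : EReal) ≤ gkDim 𝕜 (fun n => As 𝕜 n ⧸ truncation 𝕜 k n) := by
  obtain ⟨θ, hθ, hθ0⟩ := exists_isProper_ne_zero 𝕜 hm
  refine succ_le_gkDim_of_choose_le m ((isOperadicIdeal_truncation k).choose_le_finrank hθ ?_)
  rwa [truncation_eq_bot hmk, Submodule.mem_bot]

/-- With at most one argument `x` different from `1`, evaluation factors through the commutative
algebra `𝕜[X]`, where `θ` contributes only its coefficient sum, which is zero on the first
truncation. -/
theorem truncation_one_le_truncation_two (n : ℕ) : truncation 𝕜 1 n ≤ truncation 𝕜 2 n := by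
  intro θ hθ
  rw [mem_truncation_iff] at hθ ⊢
  intro f hf
  have h1 : eval (fun _ => (1 : 𝕜)) θ = 0 := by
    have := hθ (fun _ => 1) (by simp)
    rw [eval_one_eq_algebraMap] at this
    exact FreeAlgebra.algebraMap_leftInverse.injective (this.trans (map_zero _).symm)
  obtain ⟨x, hx⟩ : ∃ x, ∀ i, f i = 1 ∨ f i = x := by
    rcases (Set.ncard_le_one_iff_eq (Set.toFinite _)).1 (Nat.lt_succ_iff.1 hf) with h | ⟨j, h⟩
    · exact ⟨1, fun i => Or.inl (not_not.1 (Set.eq_empty_iff_forall_notMem.1 h i))⟩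
    · refine ⟨f j, fun i => or_iff_not_imp_left.2 fun hi => ?_⟩
      have : i ∈ ({j} : Set (Fin n)) := h ▸ hi
      rw [Set.mem_singleton_iff.1 this]
  classical
  have : f = Polynomial.aeval x ∘
      fun i => if f i = 1 then (1 : Polynomial 𝕜) else Polynomial.X := by
    funext i
    rcases hx i with h | h <;> by_cases h' : f i = 1 <;> simp_all
  rw [this, ← map_eval, eval_of_comm, eval_one_eq_algebraMap, h1]
  simp

end main

end AsOperad

/-- For an operadic ideal `I` of `As` the quotient operad `As/I` has the components
`(As/I)(n) = As(n)/I(n)`. -/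
theorem corollary0p2 {𝕜 : Type*} [Field 𝕜] (k : ℕ) (hk : 1 ≤ k) :
    AsOperad.IsOperadicIdeal (AsOperad.truncation 𝕜 k) ∧
    (∀ I : (n : ℕ) → Submodule 𝕜 (AsOperad.As 𝕜 n), AsOperad.IsOperadicIdeal I →
      (AsOperad.gkDim 𝕜 (fun n => AsOperad.As 𝕜 n ⧸ I n) ≤ (k : EReal) ↔
        ∀ n, AsOperad.truncation 𝕜 k n ≤ I n)) ∧
    AsOperad.gkDim 𝕜 (fun n => AsOperad.As 𝕜 n ⧸ AsOperad.truncation 𝕜 k n) =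
      (if k ≤ 2 then 1 else (k : EReal)) := by
  refine ⟨AsOperad.isOperadicIdeal_truncation k, fun I hI => ⟨hI.truncation_le_of_gkDim_le,
    AsOperad.gkDim_quotient_le_of_truncation_le hk⟩, ?_⟩
  split_ifs with h2
  · refine le_antisymm ?_ ?_
    -- For `k = 2` the general bound would only give `2`; containing the first truncation improves
    -- it to `1`.
    · have : ∀ n, AsOperad.truncation 𝕜 1 n ≤ AsOperad.truncation 𝕜 k n := by
        intro n
        interval_cases k
        · exact le_rfl
        · exact AsOperad.truncation_one_le_truncation_two n
      exact_mod_cast AsOperad.gkDim_quotient_le_of_truncation_le le_rfl this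
    · simpa using AsOperad.succ_le_gkDim_quotient_truncation (𝕜 := 𝕜) hk zero_ne_one
  · refine le_antisymm (AsOperad.gkDim_quotient_le_of_truncation_le hk fun _ => le_rfl) ?_
    have := AsOperad.succ_le_gkDim_quotient_truncation (𝕜 := 𝕜) (k := k) (m := k - 1) (by omega)
      (by omega)
    rwa [Nat.sub_add_cancel hk] at this
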